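/- Let $\Bbbk$ be an arbitrary field and let $H=(H,m,\eta,\Delta,\epsilon,S)$ be a finite-dimensional Hopf algebra over $\Bbbk$, with dual Hopf algebra $H^*$ (convolution product, coproduct dual to $m$). Write $G(\cdot)$ for the group of grouplike elements and $Z(\cdot)$ for the center of an algebra. A universal $R$-matrix of $H$ is an invertible element $R\in H\otimes H$ such that $(\Delta\otimes\mathrm{id})(R)=R_{13}R_{23}$, $(\mathrm{id}\otimes\Delta)(R)=R_{13}R_{12}$ and $\Delta^{op}(h)=R\Delta(h)R^{-1}$ for all $h\in H$; the pair $(H,R)$ is then called a quasitriangular Hopf algebra. (A) Suppose that $|G(H^*)|\neq 1$, $G(H^*)\cap Z(H^*)=\{1\}$, $G(H)\cap Z(H)=\{1\}$, and that there exists an odd prime factor $p$ of $|G(H^*)|$ such that $\alpha(g)\neq 1$ for every $g\in G(H)$ of order $p$ and every $\alpha\in G(H^*)$ of order $p$. Then $H$ does not have any universal $R$-matrix. (B) Suppose that $(H,R)$ is quasitriangular for some $R$. Then one of the following holds: (i) $|G(H^*)|=1$; (ii) $|G(H^*)|\neq 1$ and $G(H^*)\cap Z(H^*)\neq\{1\}$;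 (iii) $|G(H^*)|\neq 1$, $G(H^*)\cap Z(H^*)=\{1\}$ and $G(H)\cap Z(H)\neq\{1\}$; (iv) $|G(H^*)|\neq 1$, $G(H^*)\cap Z(H^*)=\{1\}$, $G(H)\cap Z(H)=\{1\}$, and for every odd prime factor $p$ of $|G(H^*)|$ there exist $g\in G(H)$ of order $p$ and $\alpha\in G(H^*)$ of order $p$ with $\alpha(g)=1$, and moreover $p^2\mid\dim_{\Bbbk} H$. -/

import Mathlib

open scoped TensorProduct

noncomputable section

/-- The linear dual `H^* = Hom_k(H, k)`, as the carrier of the dual Hopf algebra. -/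
def HopfDual (k H : Type*) [Field k] [Ring H] [HopfAlgebra k H] : Type _ := Module.Dual k H

namespace HopfDual

open Coalgebra WithConv TensorProduct

section Algebra

variable {k H : Type*} [Field k] [Ring H] [HopfAlgebra k H]

instance : AddCommGroup (HopfDual k H) := inferInstanceAs (AddCommGroup (H →ₗ[k] k))

instance : Module k (HopfDual k H) := inferInstanceAs (Module k (H →ₗ[k] k))

instance : FunLike (HopfDual k H) H k := inferInstanceAs (FunLike (H →ₗ[k] k) H k)

instance : LinearMapClass (HopfDual k H) k H k :=
  inferInstanceAs (LinearMapClass (H →ₗ[k] k) k H k)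

variable (k H) in
/-- `H^*` as the linear dual of the vector space `H`. -/
def toDual : HopfDual k H ≃ₗ[k] Module.Dual k H := LinearEquiv.refl k (Module.Dual k H)

/-- The convolution product `(f * g)(h) = ∑ f(h₁) g(h₂)`. -/
instance : Mul (HopfDual k H) where
  mul f g := (toDual k H).symm
    (LinearMap.mul' k k ∘ₗ TensorProduct.map (toDual k H f) (toDual k H g) ∘ₗ Coalgebra.comul)

/-- The unit of the convolution product is the counit of `H`. -/
instance : One (HopfDual k H) where
  one := (toDual k H).symm Coalgebra.counit

@[simp] lemma toDual_apply (f : HopfDual k H) (a : H) : toDual k H f a = f a := rfl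

@[simp] lemma toDual_symm_apply (f : Module.Dual k H) (a : H) : (toDual k H).symm f a = f a := rfl

@[ext] lemma ext {f g : HopfDual k H} (h : ∀ a : H, f a = g a) : f = g := DFunLike.ext f g h

@[simp] lemma zero_apply (a : H) : (0 : HopfDual k H) a = 0 := rfl

@[simp] lemma add_apply (f g : HopfDual k H) (a : H) : (f + g) a = f a + g a := rfl

@[simp] lemma smul_apply (c : k) (f : HopfDual k H) (a : H) : (c • f) a = c * f a := rfl

@[simp] lemma one_apply (a : H) : (1 : HopfDual k H) a = counit (R := k) a := rfl

lemma mul_def (f g : HopfDual k H) (a : H) :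
    (f * g) a = LinearMap.mul' k k
      (TensorProduct.map (toDual k H f) (toDual k H g) (Coalgebra.comul a)) := rfl

lemma mul_apply {ι : Type*} {a : H} (ra : Coalgebra.Repr k a ι) (f g : HopfDual k H) :
    (f * g) a = ∑ i ∈ ra.index, f (ra.left i) * g (ra.right i) :=
  ra.convMul_apply (toConv (toDual k H f)) (toConv (toDual k H g))

lemma conv_mul (f g : HopfDual k H) :
    (toConv (toDual k H (f * g))) = toConv (toDual k H f) * toConv (toDual k H g) := rfl

lemma conv_one : toConv (toDual k H 1) = 1 := rfl

lemma conv_inj {f g : HopfDual k H}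
    (h : toConv (toDual k H f) = toConv (toDual k H g)) : f = g := toConv_injective h

instance : Ring (HopfDual k H) :=
  { (inferInstance : AddCommGroup (HopfDual k H)) with
    mul_assoc := fun f g h => conv_inj (by simp only [conv_mul, mul_assoc])
    one_mul := fun f => conv_inj (by rw [conv_mul, conv_one, one_mul])
    mul_one := fun f => conv_inj (by rw [conv_mul, conv_one, mul_one])
    zero_mul := fun f => by ext a; rw [mul_apply (ℛ k a)]; simp
    mul_zero := fun f => by ext a; rw [mul_apply (ℛ k a)]; simp
    left_distrib := fun f g h => by
      ext a
      rw [add_apply, mul_apply (ℛ k a), mul_apply (ℛ k a), mul_apply (ℛ k a)]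
      simp [mul_add, Finset.sum_add_distrib]
    right_distrib := fun f g h => by
      ext a
      rw [add_apply, mul_apply (ℛ k a), mul_apply (ℛ k a), mul_apply (ℛ k a)]
      simp [add_mul, Finset.sum_add_distrib] }

instance : Algebra k (HopfDual k H) :=
  Algebra.ofModule
    (fun c f g => by
      ext a
      rw [smul_apply, mul_apply (ℛ k a), mul_apply (ℛ k a)]
      simp [Finset.mul_sum, mul_assoc])
    (fun c f g => by
      ext a
      rw [smul_apply, mul_apply (ℛ k a), mul_apply (ℛ k a)]
      simp [Finset.mul_sum, mul_left_comm])

lemma algebraMap_apply (c : k) (a : H) :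
    algebraMap k (HopfDual k H) c a = c * counit (R := k) a := by
  rw [Algebra.algebraMap_eq_smul_one]
  rfl

end Algebra

variable (k H : Type*) [Field k] [Ring H] [HopfAlgebra k H]

/-- The counit of `H^*` is evaluation at `1`. -/
def counitMap : HopfDual k H →ₗ[k] k :=
  (LinearMap.applyₗ (1 : H)) ∘ₗ (toDual k H).toLinearMap

/-- The antipode of `H^*` is the transpose of the antipode of `H`. -/
def antipodeMap : HopfDual k H →ₗ[k] HopfDual k H :=
  (toDual k H).symm.toLinearMap ∘ₗ (HopfAlgebra.antipode k (A := H)).dualMap ∘ₗ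
    (toDual k H).toLinearMap

variable {k H}

lemma counitMap_apply (f : HopfDual k H) : counitMap k H f = f 1 := rfl

lemma antipodeMap_apply (f : HopfDual k H) (a : H) :
    antipodeMap k H f a = f (HopfAlgebra.antipode k a) := rfl

variable [FiniteDimensional k H]

instance : FiniteDimensional k (HopfDual k H) :=
  inferInstanceAs (FiniteDimensional k (Module.Dual k H))

variable (k H)

/-- The canonical isomorphism `H^* ⊗ H^* ≃ (H ⊗ H)^*`, `(f ⊗ g)(a ⊗ b) = f(a) g(b)`. -/
def pairEquiv : HopfDual k H ⊗[k] HopfDual k H ≃ₗ[k] Module.Dual k (H ⊗[k] H) :=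
  TensorProduct.congr (toDual k H) (toDual k H) ≪≫ₗ TensorProduct.dualDistribEquiv k H H

/-- The canonical isomorphism `H^* ⊗ (H^* ⊗ H^*) ≃ (H ⊗ (H ⊗ H))^*`. -/
def tripleEquiv : HopfDual k H ⊗[k] (HopfDual k H ⊗[k] HopfDual k H) ≃ₗ[k]
    Module.Dual k (H ⊗[k] (H ⊗[k] H)) :=
  TensorProduct.congr (toDual k H) (pairEquiv k H) ≪≫ₗ
    TensorProduct.dualDistribEquiv k H (H ⊗[k] H)

/-- The comultiplication of `H^*` is the transpose of the multiplication of `H`: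
`∑ f₁(a) f₂(b) = f(a b)`. -/
def comulMap : HopfDual k H →ₗ[k] HopfDual k H ⊗[k] HopfDual k H :=
  (pairEquiv k H).symm.toLinearMap ∘ₗ (LinearMap.mul' k H).dualMap ∘ₗ (toDual k H).toLinearMap

variable {k H}

lemma pairEquiv_tmul (f g : HopfDual k H) (a b : H) :
    pairEquiv k H (f ⊗ₜ[k] g) (a ⊗ₜ[k] b) = f a * g b := rfl

lemma tripleEquiv_tmul (f : HopfDual k H) (t : HopfDual k H ⊗[k] HopfDual k H) (a : H)
    (u : H ⊗[k] H) :
    tripleEquiv k H (f ⊗ₜ[k] t) (a ⊗ₜ[k] u) = f a * pairEquiv k H t u := rfl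

lemma pair_ext {s t : HopfDual k H ⊗[k] HopfDual k H}
    (h : ∀ a b : H, pairEquiv k H s (a ⊗ₜ[k] b) = pairEquiv k H t (a ⊗ₜ[k] b)) : s = t :=
  (pairEquiv k H).injective (TensorProduct.ext' h)

lemma triple_ext {s t : HopfDual k H ⊗[k] (HopfDual k H ⊗[k] HopfDual k H)}
    (h : ∀ a b c : H, tripleEquiv k H s (a ⊗ₜ[k] (b ⊗ₜ[k] c)) =
      tripleEquiv k H t (a ⊗ₜ[k] (b ⊗ₜ[k] c))) : s = t := by
  apply (tripleEquiv k H).injective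
  ext a b c
  exact h a b c

lemma pair_comulMap (f : HopfDual k H) (a b : H) :
    pairEquiv k H (comulMap k H f) (a ⊗ₜ[k] b) = f (a * b) := by
  simp [comulMap]

lemma triple_assoc_tmul (s : HopfDual k H ⊗[k] HopfDual k H) (g : HopfDual k H) (a b c : H) :
    tripleEquiv k H (TensorProduct.assoc k _ _ _ (s ⊗ₜ[k] g)) (a ⊗ₜ[k] (b ⊗ₜ[k] c)) =
      pairEquiv k H s (a ⊗ₜ[k] b) * g c := by
  induction s with
  | zero => simp
  | tmul f f' => simp [tripleEquiv_tmul, pairEquiv_tmul, mul_assoc]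
  | add x y hx hy => simp only [add_tmul, map_add, LinearMap.add_apply, hx, hy, add_mul]

lemma triple_rTensor (t : HopfDual k H ⊗[k] HopfDual k H) (a b c : H) :
    tripleEquiv k H (TensorProduct.assoc k _ _ _ ((comulMap k H).rTensor _ t))
      (a ⊗ₜ[k] (b ⊗ₜ[k] c)) = pairEquiv k H t ((a * b) ⊗ₜ[k] c) := by
  induction t with
  | zero => simp
  | tmul f g => rw [LinearMap.rTensor_tmul, triple_assoc_tmul, pair_comulMap, pairEquiv_tmul]
  | add x y hx hy => simp only [map_add, LinearMap.add_apply, hx, hy]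

lemma triple_lTensor (t : HopfDual k H ⊗[k] HopfDual k H) (a b c : H) :
    tripleEquiv k H ((comulMap k H).lTensor _ t) (a ⊗ₜ[k] (b ⊗ₜ[k] c)) =
      pairEquiv k H t (a ⊗ₜ[k] (b * c)) := by
  induction t with
  | zero => simp
  | tmul f g => rw [LinearMap.lTensor_tmul, tripleEquiv_tmul, pair_comulMap, pairEquiv_tmul]
  | add x y hx hy => simp only [map_add, LinearMap.add_apply, hx, hy]

lemma rTensor_counitMap (t : HopfDual k H ⊗[k] HopfDual k H) (a : H) :
    (TensorProduct.lid k (HopfDual k H) ((counitMap k H).rTensor _ t)) a =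
      pairEquiv k H t (1 ⊗ₜ[k] a) := by
  induction t with
  | zero => simp
  | tmul f g => simp [counitMap_apply, pairEquiv_tmul]
  | add x y hx hy => simp only [map_add, add_apply, LinearMap.add_apply, hx, hy]

lemma lTensor_counitMap (t : HopfDual k H ⊗[k] HopfDual k H) (a : H) :
    (TensorProduct.rid k (HopfDual k H) ((counitMap k H).lTensor _ t)) a =
      pairEquiv k H t (a ⊗ₜ[k] 1) := by
  induction t with
  | zero => simp
  | tmul f g => simp [counitMap_apply, pairEquiv_tmul, mul_comm]
  | add x y hx hy => simp only [map_add, add_apply, LinearMap.add_apply, hx, hy]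

instance instCoalgebra : Coalgebra k (HopfDual k H) where
  comul := comulMap k H
  counit := counitMap k H
  coassoc := by
    ext1 f
    apply triple_ext
    intro a b c
    simp only [LinearMap.comp_apply, LinearEquiv.coe_coe]
    rw [triple_rTensor, triple_lTensor, pair_comulMap, pair_comulMap, mul_assoc]
  rTensor_counit_comp_comul := by
    ext1 f
    apply (TensorProduct.lid k (HopfDual k H)).injective
    ext a
    rw [LinearMap.comp_apply, rTensor_counitMap, pair_comulMap]
    simp
  lTensor_counit_comp_comul := by
    ext1 f
    apply (TensorProduct.rid k (HopfDual k H)).injective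
    ext a
    rw [LinearMap.comp_apply, lTensor_counitMap, pair_comulMap]
    simp

lemma comul_def (f : HopfDual k H) : comul (R := k) f = comulMap k H f := rfl

lemma counit_def (f : HopfDual k H) : counit (R := k) f = f 1 := rfl

lemma pair_mul {ι κ : Type*} (s t : HopfDual k H ⊗[k] HopfDual k H) {a b : H}
    (ra : Coalgebra.Repr k a ι) (rb : Coalgebra.Repr k b κ) :
    pairEquiv k H (s * t) (a ⊗ₜ[k] b) = ∑ i ∈ ra.index, ∑ j ∈ rb.index,
      pairEquiv k H s (ra.left i ⊗ₜ[k] rb.left j) *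
        pairEquiv k H t (ra.right i ⊗ₜ[k] rb.right j) := by
  induction s with
  | zero => simp
  | add x y hx hy =>
    simp only [add_mul, map_add, LinearMap.add_apply, hx, hy, Finset.sum_add_distrib]
  | tmul f f' =>
    induction t with
    | zero => simp
    | add x y hx hy =>
      simp only [mul_add, map_add, LinearMap.add_apply, hx, hy, Finset.sum_add_distrib]
    | tmul g g' =>
      rw [Algebra.TensorProduct.tmul_mul_tmul, pairEquiv_tmul, mul_apply ra, mul_apply rb,
        Finset.sum_mul_sum]
      refine Finset.sum_congr rfl fun i _ => Finset.sum_congr rfl fun j _ => ?_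
      rw [pairEquiv_tmul, pairEquiv_tmul]
      ring

instance instBialgebra : Bialgebra k (HopfDual k H) :=
  Bialgebra.mk' k (HopfDual k H)
    (by rw [counit_def]; simp)
    (by
      intro f g
      rw [counit_def, counit_def, counit_def, mul_def]
      simp [Algebra.TensorProduct.one_def])
    (by
      apply pair_ext
      intro a b
      rw [comul_def, pair_comulMap, Algebra.TensorProduct.one_def, pairEquiv_tmul]
      simp)
    (by
      intro f g
      apply pair_ext
      intro a b
      rw [comul_def, comul_def, comul_def, pair_comulMap,
        mul_apply ((ℛ k a).mul (ℛ k b)), pair_mul _ _ (ℛ k a) (ℛ k b), ← Finset.sum_product']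
      refine Finset.sum_congr rfl fun i _ => ?_
      rw [pair_comulMap, pair_comulMap]
      rfl)

lemma mul'_rTensor_antipodeMap {ι : Type*} (t : HopfDual k H ⊗[k] HopfDual k H) {a : H}
    (ra : Coalgebra.Repr k a ι) :
    (LinearMap.mul' k (HopfDual k H) ((antipodeMap k H).rTensor _ t)) a =
      ∑ i ∈ ra.index,
        pairEquiv k H t (HopfAlgebra.antipode k (ra.left i) ⊗ₜ[k] ra.right i) := by
  induction t with
  | zero => simp
  | tmul f g =>
    rw [LinearMap.rTensor_tmul, LinearMap.mul'_apply, mul_apply ra]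
    rfl
  | add x y hx hy =>
    simp only [map_add, add_apply, LinearMap.add_apply, hx, hy, Finset.sum_add_distrib]

lemma mul'_lTensor_antipodeMap {ι : Type*} (t : HopfDual k H ⊗[k] HopfDual k H) {a : H}
    (ra : Coalgebra.Repr k a ι) :
    (LinearMap.mul' k (HopfDual k H) ((antipodeMap k H).lTensor _ t)) a =
      ∑ i ∈ ra.index,
        pairEquiv k H t (ra.left i ⊗ₜ[k] HopfAlgebra.antipode k (ra.right i)) := by
  induction t with
  | zero => simp
  | tmul f g =>
    rw [LinearMap.lTensor_tmul, LinearMap.mul'_apply, mul_apply ra]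
    rfl
  | add x y hx hy =>
    simp only [map_add, add_apply, LinearMap.add_apply, hx, hy, Finset.sum_add_distrib]

/-- The dual Hopf algebra `H^*` of a finite-dimensional Hopf algebra `H`. -/
instance instHopfAlgebra : HopfAlgebra k (HopfDual k H) where
  antipode := antipodeMap k H
  mul_antipode_rTensor_comul := by
    ext1 f
    ext a
    rw [LinearMap.comp_apply, LinearMap.comp_apply, mul'_rTensor_antipodeMap _ (ℛ k a)]
    simp only [comul_def, pair_comulMap]
    rw [← map_sum, HopfAlgebra.sum_antipode_mul_eq_smul]
    simp [counit_def, algebraMap_apply, mul_comm]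
  mul_antipode_lTensor_comul := by
    ext1 f
    ext a
    rw [LinearMap.comp_apply, LinearMap.comp_apply, mul'_lTensor_antipodeMap _ (ℛ k a)]
    simp only [comul_def, pair_comulMap]
    rw [← map_sum, HopfAlgebra.sum_mul_antipode_eq_smul]
    simp [counit_def, algebraMap_apply, mul_comm]

end HopfDual

section RMatrix

variable (k : Type*) {H : Type*} [Field k] [Ring H] [HopfAlgebra k H]

/-- `R ↦ R₁₂`, that is `x ⊗ y ↦ x ⊗ y ⊗ 1`. -/
def leg12 : H ⊗[k] H →ₐ[k] H ⊗[k] (H ⊗[k] H) :=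
  Algebra.TensorProduct.map (AlgHom.id k H) Algebra.TensorProduct.includeLeft

/-- `R ↦ R₁₃`, that is `x ⊗ y ↦ x ⊗ 1 ⊗ y`. -/
def leg13 : H ⊗[k] H →ₐ[k] H ⊗[k] (H ⊗[k] H) :=
  Algebra.TensorProduct.map (AlgHom.id k H) Algebra.TensorProduct.includeRight

/-- `R ↦ R₂₃`, that is `x ⊗ y ↦ 1 ⊗ x ⊗ y`. -/
def leg23 : H ⊗[k] H →ₐ[k] H ⊗[k] (H ⊗[k] H) :=
  Algebra.TensorProduct.includeRight

/-- `R` is a universal `R`-matrix of the Hopf algebra `H`, i.e. `(H, R)` is quasitriangular. -/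
structure IsUniversalRMatrix (R : (H ⊗[k] H)ˣ) : Prop where
  comul_left : TensorProduct.assoc k H H H
      ((Coalgebra.comul (R := k) (A := H)).rTensor H (R : H ⊗[k] H)) =
    leg13 k (R : H ⊗[k] H) * leg23 k (R : H ⊗[k] H)
  comul_right : (Coalgebra.comul (R := k) (A := H)).lTensor H (R : H ⊗[k] H) =
    leg13 k (R : H ⊗[k] H) * leg12 k (R : H ⊗[k] H)
  comul_op : ∀ h : H, TensorProduct.comm k H H (Coalgebra.comul (R := k) h) =
    (R : H ⊗[k] H) * Coalgebra.comul (R := k) h * ((R⁻¹ : (H ⊗[k] H)ˣ) : H ⊗[k] H)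

end RMatrix

end

/-!
Let `R` be a universal `R`-matrix of `H`. Evaluating one tensor factor of `R` at a grouplike
`α ∈ G(H^*)`, which is a character of `H`, gives grouplikes `φ(α) = (α ⊗ id)(R)` and
`ψ(α) = (id ⊗ α)(R)` of `H`, and `φ : G(H^*) → G(H)` is a group homomorphism
(`IsUniversalRMatrix.groupLikeHom`). Applying `α` to `Δ^op(h) R = R Δ(h)` shows that `φ(α)`
intertwines the two shifts `h ↦ ∑ α(h₁) h₂` and `h ↦ ∑ h₁ α(h₂)`, and that `ψ(α)` intertwines them in
the other direction. So `φ(α) = 1` makes `α` central in `H^*`, and `φ(α) ψ(α)` is always central in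
`H`. If neither `H^*` nor `H` has a nontrivial central grouplike, then `φ` is injective and
`ψ(α) = φ(α)⁻¹`. Hence `α(φ(α)) = (α ⊗ α)(R) = α(ψ(α)) = α(φ(α))⁻¹`, so `α(φ(α))² = 1`; if `α` has odd
prime order `p`, also `α(φ(α))ᵖ = 1`, and `α(φ(α)) = 1`. By Cauchy's theorem this happens for every
odd prime `p` dividing `|G(H^*)|` (`IsUniversalRMatrix.exists_apply_eq_one`).

It remains to see that `g ∈ G(H)` and `α ∈ G(H^*)` of order `p` with `α(g) = 1` force `p² ∣ dim H`
(`GroupLike.sq_dvd_finrank`). This rests on a case of the Nichols-Zoeller theorem: a right coideal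
`M ⊆ H` stable under left multiplication by `g` is free over the group algebra of `⟨g⟩`, so that the
norm element `1 + g + ⋯ + g^(p-1)` has rank `dim M / p` on `M`
(`GroupLike.prime_mul_finrank_range_cyclicNorm`). Applied to `α` on `H^*` and dualized, it shows that
the norm element of `α` has image of dimension `dim H / p` in `H`; this image is a right coideal, and
it is stable under `g` because `α(g) = 1`, so the result applies to it as well.

For the freeness, the Galois map `m ⊗ h ↦ ∑ m₁ ⊗ m₂ h` identifies `M ⊗ H` with `g` acting on `M` alone
with `M ⊗ H` with `g` acting diagonally. What is left is linear algebra
(`prime_mul_finrank_range_cyclicNorm`). If `p` is invertible in the field, pass to the algebraic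
closure, where both actions are diagonal: the multiplicity function of the eigenvalues on `M`
satisfies a mean value property, and the maximum principle makes it constant on the `p`-th roots of
unity. In characteristic `p`, the rank of the norm element counts the free summands, and `H` contains
a free summand since the powers of `g` are linearly independent; comparing the ranks on the two sides
leaves no room for a non-free part of `M`.
-/

noncomputable section

/-! ### Cyclic group actions in characteristic `p` -/

/-- The norm element `1 + f + ⋯ + f ^ (p - 1)` of the cyclic group of order `p`, acting through an
endomorphism `f` with `f ^ p = 1`. -/
def cyclicNorm {k M : Type*} [Field k] [AddCommGroup M] [Module k M] (p : ℕ)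
    (f : Module.End k M) : Module.End k M :=
  ∑ i ∈ Finset.range p, f ^ i

section CharP

variable {k M V : Type*} [Field k] [AddCommGroup M] [Module k M] [AddCommGroup V] [Module k V]
  {p : ℕ} [Fact p.Prime]

lemma cyclicNorm_eq_sub_one_pow [CharP k p] (f : Module.End k M) :
    cyclicNorm p f = (f - 1) ^ (p - 1) := by
  have h : (Polynomial.X - 1 : Polynomial k) ^ (p - 1) =
      ∑ i ∈ Finset.range p, Polynomial.X ^ i := by
    have h0 : (Polynomial.X - 1 : Polynomial k) ≠ 0 := by
      simpa using Polynomial.X_sub_C_ne_zero (1 : k)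
    apply mul_right_cancel₀ h0
    rw [geom_sum_mul, ← pow_succ, Nat.sub_add_cancel (Fact.out : p.Prime).one_le, sub_pow_char,
      one_pow]
  have h' := congrArg (Polynomial.aeval f) h
  simpa [cyclicNorm] using h'.symm

lemma sub_one_pow_char_eq_zero [CharP k p] {f : Module.End k M} (hf : f ^ p = 1) :
    (f - 1) ^ p = 0 := by
  have h : (Polynomial.X - 1 : Polynomial k) ^ p = Polynomial.X ^ p - 1 := by
    rw [sub_pow_char, one_pow]
  have h' := congrArg (Polynomial.aeval f) h
  simpa [hf] using h'

/-- In characteristic `p`, vectors whose norms are linearly independent generate a free module over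
the group algebra of the cyclic group: the socle of that algebra is spanned by the norm element. -/
lemma linearIndependent_pow_apply [CharP k p] {ι : Type*} [Fintype ι] {f : Module.End k M}
    (hf : f ^ p = 1) (m : ι → M) (hm : LinearIndependent k fun i => cyclicNorm p f (m i)) :
    LinearIndependent k fun q : Fin p × ι => (f ^ (q.1 : ℕ)) (m q.2) := by
  have hx := sub_one_pow_char_eq_zero (p := p) hf
  have hp := (Fact.out : p.Prime).pos
  set x := f - 1 with hxdef
  have hxz : ∀ n, p ≤ n → x ^ n = 0 := fun n hn => pow_eq_zero_of_le hn hx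
  -- The powers of the nilpotent `f - 1` are independent on the `m i`.
  have hli : LinearIndependent k fun q : Fin p × ι => (x ^ (q.1 : ℕ)) (m q.2) := by
    rw [Fintype.linearIndependent_iff]
    intro a ha
    have key : ∀ n (hn : n < p), ∀ i, a (⟨n, hn⟩, i) = 0 := by
      intro n
      induction n using Nat.strong_induction_on with
      | _ n ih =>
        intro hn
        have h1 := congrArg (x ^ (p - 1 - n)) ha
        rw [map_sum, map_zero, Fintype.sum_prod_type, Finset.sum_eq_single ⟨n, hn⟩] at h1
        · have h2 : ∑ i, a (⟨n, hn⟩, i) • cyclicNorm p f (m i) = 0 := by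
            rw [← h1]
            refine Finset.sum_congr rfl fun i _ => ?_
            rw [map_smul, ← Module.End.mul_apply, ← pow_add, cyclicNorm_eq_sub_one_pow]
            congr 4
            dsimp
            omega
          exact Fintype.linearIndependent_iff.1 hm _ h2
        · intro l _ hl
          refine Finset.sum_eq_zero fun i _ => ?_
          rcases lt_or_gt_of_ne (fun h => hl (Fin.ext h) : (l : ℕ) ≠ n) with h | h
          · rw [ih l h l.2 i, zero_smul, map_zero]
          · have h' : p ≤ p - 1 - n + (l : ℕ) := by omega
            rw [map_smul, ← Module.End.mul_apply, ← pow_add, hxz _ h']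
            simp
        · simp
    rintro ⟨⟨n, hn⟩, i⟩
    exact key n hn i
  -- Both families span the same subspace, so they are independent together.
  rw [linearIndependent_iff_card_le_finrank_span]
  rw [linearIndependent_iff_card_le_finrank_span] at hli
  have : FiniteDimensional k
      (Submodule.span k (Set.range fun q : Fin p × ι => (f ^ (q.1 : ℕ)) (m q.2))) :=
    FiniteDimensional.span_of_finite k (Set.finite_range _)
  refine hli.trans (Submodule.finrank_mono ?_)
  set F := Submodule.span k (Set.range fun q : Fin p × ι => (f ^ (q.1 : ℕ)) (m q.2))
  have hF : ∀ n i, (f ^ n) (m i) ∈ F := fun n i => by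
    rw [pow_eq_pow_mod n hf]
    exact Submodule.subset_span ⟨(⟨n % p, Nat.mod_lt _ hp⟩, i), rfl⟩
  have hfF : ∀ y ∈ F, f y ∈ F := by
    intro y hy
    induction hy using Submodule.span_induction with
    | mem y hy =>
      obtain ⟨q, rfl⟩ := hy
      have := hF (q.1 + 1) q.2
      rwa [pow_succ', Module.End.mul_apply] at this
    | zero => simp
    | add a b _ _ ha hb => rw [map_add]; exact F.add_mem ha hb
    | smul c a _ ha => rw [map_smul]; exact F.smul_mem c ha
  have hxF : ∀ n i, (x ^ n) (m i) ∈ F := by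
    intro n i
    induction n with
    | zero => simpa using hF 0 i
    | succ n ih =>
      rw [pow_succ', Module.End.mul_apply, hxdef, LinearMap.sub_apply]
      exact F.sub_mem (hfF _ ih) ih
  rw [Submodule.span_le]
  rintro _ ⟨q, rfl⟩
  exact hxF _ _

/-- Coordinates dual to a family of powers as in `linearIndependent_pow_apply`. -/
lemma exists_coordinates_pow_apply [CharP k p] {ι : Type*} [Fintype ι] [DecidableEq ι]
    {f : Module.End k M}
    (hf : f ^ p = 1) (m : ι → M) (hm : LinearIndependent k fun i => cyclicNorm p f (m i)) :
    ∃ c : M →ₗ[k] (Fin p × ι → k),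
      ∀ q : Fin p × ι, c ((f ^ (q.1 : ℕ)) (m q.2)) = Pi.single q 1 := by
  have hli := linearIndependent_pow_apply hf m hm
  obtain ⟨c, hc⟩ := LinearMap.exists_leftInverse_of_injective
    (Fintype.linearCombination k fun q : Fin p × ι => (f ^ (q.1 : ℕ)) (m q.2))
    (LinearMap.ker_eq_bot.2 (linearIndependent_iff_injective_fintypeLinearCombination.1 hli))
  refine ⟨c, fun q => ?_⟩
  have := LinearMap.congr_fun hc (Pi.single q 1)
  simpa [Fintype.linearCombination_apply_single] using this

/-- Characteristic `p`: if the norm of `V` is nonzero and the norm of `M ⊗ V` has rank at most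
`dim V` times that of `M`, then `M` is free over the group algebra of the cyclic group. -/
lemma prime_mul_finrank_range_cyclicNorm_of_charP [CharP k p] [FiniteDimensional k M]
    [FiniteDimensional k V] {f : Module.End k M} {h : Module.End k V} (hf : f ^ p = 1)
    (hh : h ^ p = 1) (hV : cyclicNorm p h ≠ 0)
    (hle : Module.finrank k (LinearMap.range (cyclicNorm p (TensorProduct.map f h))) ≤
      Module.finrank k (LinearMap.range (cyclicNorm p f)) * Module.finrank k V) :
    p * Module.finrank k (LinearMap.range (cyclicNorm p f)) = Module.finrank k M := by
  have hp := (Fact.out : p.Prime).pos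
  set r := Module.finrank k (LinearMap.range (cyclicNorm p f)) with hr
  -- `m` generates a free submodule of the largest possible rank `r`.
  let e := Module.finBasis k (LinearMap.range (cyclicNorm p f))
  choose m hm using fun i => (e i).2
  have hmi : LinearIndependent k fun i => cyclicNorm p f (m i) := by
    simp_rw [hm]
    exact e.linearIndependent.map' (Submodule.subtype _) (Submodule.ker_subtype _)
  obtain ⟨c, hc⟩ := exists_coordinates_pow_apply hf m hmi
  obtain ⟨v, hv⟩ : ∃ v, cyclicNorm p h v ≠ 0 := by
    by_contra! H
    exact hV (LinearMap.ext H)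
  obtain ⟨c', hc'⟩ := exists_coordinates_pow_apply hh (fun _ : Unit => v)
    (LinearIndependent.of_subsingleton (ι := Unit) () hv)
  have hle' : p * r ≤ Module.finrank k M := by
    simpa using (linearIndependent_pow_apply hf m hmi).fintype_card_le_finrank
  set N := cyclicNorm p (TensorProduct.map f h) with hN
  have hNt : ∀ a b, N (a ⊗ₜ b) = ∑ l : Fin p, (f ^ (l : ℕ)) a ⊗ₜ[k] (h ^ (l : ℕ)) b := by
    intro a b
    rw [hN, cyclicNorm, LinearMap.sum_apply, ← Fin.sum_univ_eq_sum_range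
      (fun i => (TensorProduct.map f h ^ i) (a ⊗ₜ b))]
    refine Finset.sum_congr rfl fun l _ => ?_
    rw [TensorProduct.map_pow, TensorProduct.map_tmul]
  -- The span of the powers applied to `m`; it meets the kernel of the coordinates trivially.
  let F := Submodule.span k (Set.range fun q : Fin p × Fin r => (f ^ (q.1 : ℕ)) (m q.2))
  have hF : ∀ n i, (f ^ n) (m i) ∈ F := fun n i => by
    rw [pow_eq_pow_mod n hf]
    exact Submodule.subset_span ⟨(⟨n % p, Nat.mod_lt _ hp⟩, i), rfl⟩
  have hFc : ∀ z ∈ F, c z = 0 → z = 0 := by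
    intro z hz hz0
    obtain ⟨a, rfl⟩ := (Submodule.mem_span_range_iff_exists_fun k).1 hz
    have ha : a = 0 := by
      rw [map_sum] at hz0
      simp_rw [map_smul, hc] at hz0
      ext q
      have := congrFun hz0 q
      simpa [Finset.sum_apply, Pi.single_apply] using this
    simp [ha]
  -- `(z, b) ↦ N(z ⊗ v) + ∑ N(mᵢ ⊗ bᵢ)` is injective, so `dim (ker c) + r * dim V` is at most the rank
  -- of `N`, which leaves no room for the kernel of the coordinates.
  let L : LinearMap.ker c × (Fin r → V) →ₗ[k] LinearMap.range N :=
    (N.rangeRestrict ∘ₗ (TensorProduct.mk k M V).flip v ∘ₗ Submodule.subtype _).coprod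
      (∑ i, N.rangeRestrict ∘ₗ TensorProduct.mk k M V (m i) ∘ₗ LinearMap.proj i)
  have hL : Function.Injective L := by
    rw [← LinearMap.ker_eq_bot, LinearMap.ker_eq_bot']
    rintro ⟨⟨z, hz⟩, b⟩ hzb
    have h0 : N (z ⊗ₜ v) + ∑ i, N (m i ⊗ₜ b i) = 0 := by
      have := congrArg Subtype.val hzb
      simpa [L, LinearMap.sum_apply] using this
    simp_rw [hNt] at h0
    -- The coordinate of `v` in the second factor sends the relation to `z ∈ F`.
    have hz0 : z = 0 := by
      apply hFc z _ hz
      have h1 := congrArg ((TensorProduct.rid k M).toLinearMap ∘ₗ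
        (LinearMap.proj (⟨0, hp⟩, ()) ∘ₗ c').lTensor M) h0
      simp only [map_add, map_sum, LinearMap.comp_apply, LinearMap.lTensor_tmul, hc' (_, ()),
        LinearEquiv.coe_coe, TensorProduct.rid_tmul, LinearMap.proj_apply, map_zero] at h1
      rw [Finset.sum_eq_single ⟨0, hp⟩ (fun l _ hl => by
          rw [Pi.single_eq_of_ne fun hq => hl (congrArg Prod.fst hq).symm, zero_smul])
        (by simp)] at h1
      simp only [pow_zero, Module.End.one_apply, Pi.single_eq_same, one_smul] at h1
      rw [eq_neg_of_add_eq_zero_left h1]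
      exact F.neg_mem (F.sum_mem fun i _ => F.sum_mem fun l _ => F.smul_mem _ (hF _ _))
    subst hz0
    -- The coordinate of `m i` in the first factor isolates `b i`.
    have hb : b = 0 := by
      ext i
      have h1 := congrArg ((TensorProduct.lid k V).toLinearMap ∘ₗ
        (LinearMap.proj (⟨0, hp⟩, i) ∘ₗ c).rTensor V) h0
      simp only [map_add, map_sum, LinearMap.comp_apply, LinearMap.rTensor_tmul, hc (_, _),
        LinearEquiv.coe_coe, TensorProduct.lid_tmul, LinearMap.proj_apply, map_zero,
        zero_smul, Finset.sum_const_zero, zero_add] at h1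
      rw [Finset.sum_eq_single i (fun j _ hj => by simp [hj.symm]) (by simp),
        Finset.sum_eq_single ⟨0, hp⟩ (fun l _ hl => by
          rw [Pi.single_eq_of_ne fun hq => hl (congrArg Prod.fst hq).symm, zero_smul])
        (by simp)] at h1
      simpa using h1
    subst hb
    rfl
  have hd := LinearMap.finrank_le_finrank_of_injective hL
  rw [Module.finrank_prod, Module.finrank_pi_fintype, Finset.sum_const, Finset.card_univ,
    Fintype.card_fin, smul_eq_mul] at hd
  have hk := LinearMap.finrank_range_add_finrank_ker c
  have hrk : Module.finrank k (LinearMap.range c) ≤ p * r := by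
    simpa using Submodule.finrank_le (LinearMap.range c)
  omega

end CharP

/-! ### Cyclic group actions when `p` is invertible -/

section Combinatorial

open Finset in
/-- If multiplying the multiset of values of `a` by all values of `b` reproduces that multiset
`#κ` times, then `a` takes all `p`-th roots of unity as values equally often. Only the count of
the value `1` is recorded. -/
lemma prime_mul_card_eq_one {K ι κ : Type*} [Field K] [DecidableEq K] [Fintype ι] [Fintype κ]
    {p : ℕ} (hp : p.Prime) {a : ι → K} {b : κ → K} (ha : ∀ i, a i ^ p = 1) (hb : ∀ j, b j ^ p = 1)
    (hb1 : ∃ j, b j ≠ 1)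
    (hab : ∀ ξ : K, #{q : ι × κ | a q.1 * b q.2 = ξ} = #{q : ι × κ | a q.1 = ξ}) :
    p * #{i | a i = 1} = Fintype.card ι := by
  classical
  have hp0 := hp.pos
  rcases isEmpty_or_nonempty ι with hι | hι
  · simp
  set m : K → ℕ := fun ξ => #{i | a i = ξ} with hm
  have hb0 : ∀ j, b j ≠ 0 := fun j h => by simpa [h, hp.ne_zero] using hb j
  have hsum : ∀ ξ, ∑ j, m (ξ * (b j)⁻¹) = ∑ _j : κ, m ξ := by
    intro ξ
    have h := hab ξ
    simp_rw [card_filter, Fintype.sum_prod_type_right] at h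
    simp_rw [hm, card_filter]
    rw [← h]
    refine sum_congr rfl fun j _ => sum_congr rfl fun i _ => ?_
    simp only [eq_mul_inv_iff_mul_eq₀ (hb0 j)]
  -- Maximum principle: the count is constant along the group generated by `b j`.
  obtain ⟨i0, -, hi0⟩ := exists_max_image univ (fun i => m (a i)) univ_nonempty
  have hmax : ∀ ξ, m ξ ≤ m (a i0) := by
    intro ξ
    by_cases h : ∃ i, a i = ξ
    · obtain ⟨i, rfl⟩ := h
      exact hi0 i (mem_univ _)
    · have : m ξ = 0 := by
        simp only [hm, card_eq_zero, filter_eq_empty_iff]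
        exact fun i _ hi => h ⟨i, hi⟩
      omega
  obtain ⟨j, hj⟩ := hb1
  have hstep : ∀ ξ, m ξ = m (a i0) → m (ξ * (b j)⁻¹) = m (a i0) := by
    intro ξ hξ
    rw [← hξ]
    refine (sum_eq_sum_iff_of_le fun j _ => ?_).1 (hsum ξ) j (mem_univ j)
    rw [hξ]
    exact hmax _
  have hpow : ∀ n : ℕ, m (a i0 * (b j)⁻¹ ^ n) = m (a i0) := by
    intro n
    induction n with
    | zero => simp
    | succ n ih => rw [pow_succ, ← mul_assoc]; exact hstep _ ih
  have hprim : IsPrimitiveRoot (b j)⁻¹ p :=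
    (IsPrimitiveRoot.iff_def _ _).2 ⟨by rw [inv_pow, hb, inv_one], fun l hl => by
      rw [inv_pow, inv_eq_one] at hl
      have h1 : orderOf (b j) = p := by
        have : Fact p.Prime := ⟨hp⟩
        exact orderOf_eq_prime (hb j) hj
      rw [← h1]
      exact orderOf_dvd_of_pow_eq_one hl⟩
  have : NeZero p := ⟨hp.ne_zero⟩
  have hi00 : a i0 ≠ 0 := fun h => by simpa [h, hp.ne_zero] using ha i0
  have hall : ∀ ξ : K, ξ ^ p = 1 → m ξ = m (a i0) := by
    intro ξ hξ
    obtain ⟨n, -, hn⟩ := hprim.eq_pow_of_pow_eq_one (ξ := ξ / a i0)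
      (by rw [div_pow, hξ, ha, div_one])
    rw [← hpow n, hn, mul_div_cancel₀ _ hi00]
  have hcard : Fintype.card ι = ∑ ξ ∈ Polynomial.nthRootsFinset p (1 : K), m ξ :=
    card_eq_sum_card_fiberwise fun i _ => by
      simp [Polynomial.mem_nthRootsFinset hp0, ha]
  rw [hcard, sum_congr rfl fun ξ hξ => hall ξ ((Polynomial.mem_nthRootsFinset hp0 _).1 hξ),
    sum_const, hprim.card_nthRootsFinset, smul_eq_mul, ← hall 1 (one_pow p)]

end Combinatorial

section Diagonal

/-- Over an algebraically closed field in which `p` is invertible, a matrix whose `p`-th power is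
`1` is diagonalizable. -/
lemma Matrix.exists_conj_diagonal_of_pow_eq_one {K n : Type*} [Field K] [IsAlgClosed K] [Fintype n]
    [DecidableEq n] {p : ℕ} (hp : (p : K) ≠ 0) (A : Matrix n n K) (hA : A ^ p = 1) :
    ∃ (P : (Matrix n n K)ˣ) (d : n → K), A = P * Matrix.diagonal d * P⁻¹ := by
  set f : Module.End K (n → K) := Matrix.toLin' A with hf
  have hfp : f ^ p = 1 := by
    rw [hf, ← Matrix.toLin'_pow, hA, Matrix.toLin'_one]; rfl
  have hss : f.IsSemisimple := Module.End.isSemisimple_of_squarefree_aeval_eq_zero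
    (p := Polynomial.X ^ p - 1) (Polynomial.separable_X_pow_sub_C 1 hp one_ne_zero).squarefree
    (by simp [hfp])
  have htop : ⊤ ≤ Submodule.span K {v | ∃ μ : K, f v = μ • v} := by
    rw [← hss.iSup_eigenspace_eq_top]
    exact iSup_le fun μ v hv => Submodule.subset_span ⟨μ, Module.End.mem_eigenspace_iff.1 hv⟩
  let B₀ := Module.Basis.ofSpan htop
  let B := B₀.reindex (B₀.indexEquiv (Pi.basisFun K n))
  have hB : ∀ i, ∃ μ : K, f (B i) = μ • B i := fun i => by
    have h := Module.Basis.ofSpan_subset htop ⟨(B₀.indexEquiv (Pi.basisFun K n)).symm i, rfl⟩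
    simpa [B, B₀, Module.Basis.reindex_apply] using! h
  choose d hd using hB
  refine ⟨⟨(Pi.basisFun K n).toMatrix B, B.toMatrix (Pi.basisFun K n),
    Module.Basis.toMatrix_mul_toMatrix_flip _ _, Module.Basis.toMatrix_mul_toMatrix_flip _ _⟩,
    d, ?_⟩
  have hdiag : LinearMap.toMatrix B B f = Matrix.diagonal d := by
    ext i j
    rw [LinearMap.toMatrix_apply, hd, map_smul, B.repr_self, Matrix.diagonal_apply]
    rcases eq_or_ne i j with rfl | hij
    · simp
    · simp [hij]
  rw [← hdiag]
  show A = (Pi.basisFun K n).toMatrix B * LinearMap.toMatrix B B f * B.toMatrix (Pi.basisFun K n)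
  rw [basis_toMatrix_mul_linearMap_toMatrix_mul_basis_toMatrix, hf]
  exact (LinearMap.toMatrix'_toLin' A).symm

lemma Matrix.pow_eq_one_of_conj_diagonal_pow_eq_one {K n : Type*} [Field K] [Fintype n]
    [DecidableEq n] {p : ℕ} (P : (Matrix n n K)ˣ) {a : n → K}
    (h : (P * Matrix.diagonal a * P⁻¹ : Matrix n n K) ^ p = 1) (i : n) : a i ^ p = 1 := by
  rw [Units.conj_pow, Matrix.diagonal_pow, Units.mul_inv_eq_iff_eq_mul, one_mul] at h
  have h' : Matrix.diagonal (a ^ p) = 1 := by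
    simpa using congrArg (fun X => (↑P⁻¹ : Matrix n n K) * X) h
  simpa using congrFun (congrFun h' i) i

open Kronecker in
lemma Matrix.charpoly_conj_kronecker_conj {K n l : Type*} [Field K] [Fintype n]
    [DecidableEq n] [Fintype l] [DecidableEq l] (P : (Matrix n n K)ˣ) (Q : (Matrix l l K)ˣ)
    (a : n → K) (b : l → K) :
    ((P * Matrix.diagonal a * P⁻¹ : Matrix n n K) ⊗ₖ
      (Q * Matrix.diagonal b * Q⁻¹ : Matrix l l K)).charpoly =
      ∏ q : n × l, (Polynomial.X - Polynomial.C (a q.1 * b q.2)) := by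
  let W : (Matrix (n × l) (n × l) K)ˣ :=
    ⟨(P : Matrix n n K) ⊗ₖ (Q : Matrix l l K), (↑P⁻¹ : Matrix n n K) ⊗ₖ (↑Q⁻¹ : Matrix l l K),
      by rw [← Matrix.mul_kronecker_mul, Units.mul_inv, Units.mul_inv, Matrix.one_kronecker_one],
      by rw [← Matrix.mul_kronecker_mul, Units.inv_mul, Units.inv_mul, Matrix.one_kronecker_one]⟩
  rw [Matrix.mul_kronecker_mul, Matrix.mul_kronecker_mul, Matrix.diagonal_kronecker_diagonal]
  have h := Matrix.charpoly_units_conj W (Matrix.diagonal fun q : n × l => a q.1 * b q.2)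
  rw [← Matrix.coe_units_inv, Matrix.charpoly_diagonal] at h
  exact h

open Matrix Kronecker Finset in
/-- Matrix form of the freeness criterion when `p` is invertible. -/
lemma Matrix.prime_mul_rank_sum_pow {K n l : Type*} [Field K] [IsAlgClosed K] [Fintype n]
    [DecidableEq n] [Fintype l] [DecidableEq l] {p : ℕ} (hp : p.Prime) (hpK : (p : K) ≠ 0)
    (A : Matrix n n K) (B : Matrix l l K) (hA : A ^ p = 1) (hB : B ^ p = 1) (hB1 : B ≠ 1)
    (T : (Matrix (n × l) (n × l) K)ˣ) (hT : T * (A ⊗ₖ (1 : Matrix l l K)) = (A ⊗ₖ B) * T) :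
    p * (∑ i ∈ Finset.range p, A ^ i).rank = Fintype.card n := by
  classical
  obtain ⟨P, a, rfl⟩ := A.exists_conj_diagonal_of_pow_eq_one hpK hA
  obtain ⟨Q, b, rfl⟩ := B.exists_conj_diagonal_of_pow_eq_one hpK hB
  have ha : ∀ i, a i ^ p = 1 := pow_eq_one_of_conj_diagonal_pow_eq_one P hA
  have hb : ∀ i, b i ^ p = 1 := pow_eq_one_of_conj_diagonal_pow_eq_one Q hB
  have hb1 : ∃ j, b j ≠ 1 := by
    by_contra! h
    apply hB1
    rw [show b = fun _ => 1 from funext h, diagonal_one, mul_one, Units.mul_inv]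
  -- The spectra of `A ⊗ B` and `A ⊗ 1` agree with multiplicities.
  have hchar : ∏ q : n × l, (Polynomial.X - Polynomial.C (a q.1 * b q.2)) =
      ∏ q : n × l, (Polynomial.X - Polynomial.C (a q.1)) := by
    have h1 : (1 : Matrix l l K) = Q * diagonal (fun _ : l => (1 : K)) * Q⁻¹ := by
      rw [diagonal_one, mul_one, Units.mul_inv]
    have h := charpoly_units_conj T ((P * diagonal a * P⁻¹ : Matrix n n K) ⊗ₖ (1 : Matrix l l K))
    rw [hT, ← coe_units_inv, mul_assoc, Units.mul_inv, mul_one, charpoly_conj_kronecker_conj, h1,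
      charpoly_conj_kronecker_conj] at h
    simpa using h
  have hcount : ∀ ξ : K, #{q : n × l | a q.1 * b q.2 = ξ} = #{q : n × l | a q.1 = ξ} := by
    intro ξ
    have key : ∀ c : n × l → K,
        (∏ q : n × l, (Polynomial.X - Polynomial.C (c q))).roots.count ξ = #{q | c q = ξ} := by
      intro c
      have : ∏ q : n × l, (Polynomial.X - Polynomial.C (c q)) =
          ((Finset.univ.val.map c).map fun x => Polynomial.X - Polynomial.C x).prod := by
        rw [Multiset.map_map]; rfl
      rw [this, Polynomial.roots_multiset_prod_X_sub_C, Multiset.count_map]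
      simp only [eq_comm (a := ξ)]
      rfl
    rw [← key, ← key, hchar]
  rw [← prime_mul_card_eq_one hp ha hb hb1 hcount]
  congr 1
  have hsum : ∑ i ∈ Finset.range p, (P * diagonal a * P⁻¹ : Matrix n n K) ^ i =
      P * diagonal (∑ i ∈ Finset.range p, a ^ i) * P⁻¹ := by
    simp_rw [Units.conj_pow, diagonal_pow, ← Finset.sum_mul, ← Finset.mul_sum]
    congr 2
    ext i j
    by_cases h : i = j
    · subst h; simp [Matrix.sum_apply]
    · simp [Matrix.sum_apply, h]
  rw [hsum, rank_mul_eq_left_of_isUnit_det _ _ ((isUnit_iff_isUnit_det _).1 P⁻¹.isUnit),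
    rank_mul_eq_right_of_isUnit_det _ _ ((isUnit_iff_isUnit_det _).1 P.isUnit), rank_diagonal,
    Fintype.card_subtype]
  congr 1
  ext i
  simp only [Finset.mem_filter, Finset.mem_univ, true_and, Finset.sum_apply, Pi.pow_apply]
  constructor
  · intro h
    by_contra h1
    apply h
    have := geom_sum_mul (a i) p
    rw [ha, sub_self, mul_eq_zero] at this
    exact this.resolve_right (sub_ne_zero.2 h1)
  · intro h
    simpa [h] using hpK

end Diagonal

/-! ### The freeness criterion -/

section Freeness

variable {k M V : Type*} [Field k] [AddCommGroup M] [Module k M] [AddCommGroup V] [Module k V]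

lemma LinearMap.finrank_range_baseChange (K : Type*) [Field K] [Algebra k K]
    (f : M →ₗ[k] V) :
    Module.finrank K (LinearMap.range (f.baseChange K)) = Module.finrank k (LinearMap.range f) := by
  have hinj : Function.Injective ((Submodule.subtype (LinearMap.range f)).baseChange K) :=
    Module.Flat.lTensor_preserves_injective_linearMap (M := K) _
      (Submodule.subtype_injective (LinearMap.range f))
  have hsurj : Function.Surjective (f.rangeRestrict.baseChange K) :=
    LinearMap.lTensor_surjective K f.surjective_rangeRestrict
  conv_lhs => rw [show f = Submodule.subtype _ ∘ₗ f.rangeRestrict from rfl,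
    LinearMap.baseChange_comp]
  rw [LinearMap.range_comp_of_range_eq_top _ (LinearMap.range_eq_top.2 hsurj),
    LinearMap.finrank_range_of_inj hinj, Module.finrank_baseChange]

lemma LinearMap.finrank_range_rTensor [FiniteDimensional k M] [FiniteDimensional k V]
    (f : Module.End k M) :
    Module.finrank k (LinearMap.range (f.rTensor V)) =
      Module.finrank k (LinearMap.range f) * Module.finrank k V := by
  have hinj : Function.Injective ((Submodule.subtype (LinearMap.range f)).rTensor V) :=
    Module.Flat.rTensor_preserves_injective_linearMap _
      (Submodule.subtype_injective (LinearMap.range f))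
  have hsurj : Function.Surjective (f.rangeRestrict.rTensor V) :=
    LinearMap.rTensor_surjective V f.surjective_rangeRestrict
  conv_lhs => rw [show f = Submodule.subtype _ ∘ₗ f.rangeRestrict from rfl,
    LinearMap.rTensor_comp]
  rw [LinearMap.range_comp_of_range_eq_top _ (LinearMap.range_eq_top.2 hsurj),
    LinearMap.finrank_range_of_inj hinj, Module.finrank_tensorProduct]

lemma Matrix.rank_map_algebraMap (K : Type*) [Field K] [Algebra k K] {n : Type*} [Fintype n]
    [DecidableEq n] (A : Matrix n n k) : (A.map (algebraMap k K)).rank = A.rank := by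
  let b := Pi.basisFun k n
  have h := LinearMap.toMatrix_baseChange (A := K) (Matrix.toLin b b A) b b
  rw [LinearMap.toMatrix_toLin] at h
  rw [← h, Matrix.rank_eq_finrank_range_toLin A b b, ← LinearMap.finrank_range_baseChange K,
    Matrix.rank_eq_finrank_range_toLin _ (Algebra.TensorProduct.basis K b)
      (Algebra.TensorProduct.basis K b),
    Matrix.toLin_toMatrix]

open Kronecker in
/-- The freeness criterion: if the cyclic group of order `p` acts on `M` and `V`, nontrivially
and with nonzero norm on `V`, and `M ⊗ V` with the diagonal action is isomorphic to `M ⊗ V` with the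
action on `M` alone, then `M` is free over the group algebra. Freeness is recorded as the
statement that the norm element has rank `dim M / p`. -/
theorem prime_mul_finrank_range_cyclicNorm [FiniteDimensional k M] [FiniteDimensional k V]
    {p : ℕ} (hp : p.Prime) {f : Module.End k M} {h : Module.End k V} (hf : f ^ p = 1)
    (hh : h ^ p = 1) (h1 : h ≠ 1) (hV : cyclicNorm p h ≠ 0)
    (Θ : M ⊗[k] V ≃ₗ[k] M ⊗[k] V)
    (hΘ : Θ.toLinearMap ∘ₗ f.rTensor V = TensorProduct.map f h ∘ₗ Θ.toLinearMap) :
    p * Module.finrank k (LinearMap.range (cyclicNorm p f)) = Module.finrank k M := by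
  have : Fact p.Prime := ⟨hp⟩
  by_cases hpk : (p : k) = 0
  · have : CharP k p := (CharP.charP_iff_prime_eq_zero hp).2 hpk
    refine prime_mul_finrank_range_cyclicNorm_of_charP hf hh hV ?_
    have hpow : ∀ n : ℕ, Θ.toLinearMap ∘ₗ (f ^ n).rTensor V =
        (TensorProduct.map f h ^ n) ∘ₗ Θ.toLinearMap := by
      intro n
      induction n with
      | zero => ext; simp [Module.End.one_eq_id]
      | succ n ih =>
        rw [pow_succ, pow_succ, Module.End.mul_eq_comp, LinearMap.rTensor_comp,
          ← LinearMap.comp_assoc, ih, LinearMap.comp_assoc, hΘ, Module.End.mul_eq_comp,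
          LinearMap.comp_assoc]
    have hN : Θ.toLinearMap ∘ₗ (cyclicNorm p f).rTensor V =
        cyclicNorm p (TensorProduct.map f h) ∘ₗ Θ.toLinearMap := by
      ext a b
      have : ∀ n : ℕ, Θ ((f ^ n) a ⊗ₜ b) = (TensorProduct.map f h ^ n) (Θ (a ⊗ₜ b)) :=
        fun n => LinearMap.congr_fun (hpow n) (a ⊗ₜ b)
      simp [cyclicNorm, LinearMap.sum_apply, TensorProduct.sum_tmul, this]
    rw [← LinearMap.finrank_range_rTensor (V := V) (cyclicNorm p f),
      ← LinearMap.range_comp_of_range_eq_top (cyclicNorm p (TensorProduct.map f h)) Θ.range,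
      ← hN, LinearMap.range_comp]
    exact (LinearEquiv.finrank_map_eq Θ _).le
  · let K := AlgebraicClosure k
    let φ : k →+* K := algebraMap k K
    let b := Module.finBasis k M
    let c := Module.finBasis k V
    let A := LinearMap.toMatrix b b f
    let B := LinearMap.toMatrix c c h
    let T := LinearMap.toMatrix (b.tensorProduct c) (b.tensorProduct c) Θ.toLinearMap
    let T' := LinearMap.toMatrix (b.tensorProduct c) (b.tensorProduct c) Θ.symm.toLinearMap
    have hA : A ^ p = 1 := by
      show LinearMap.toMatrixAlgEquiv b f ^ p = 1
      rw [← map_pow, hf, map_one]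
    have hB : B ^ p = 1 := by
      show LinearMap.toMatrixAlgEquiv c h ^ p = 1
      rw [← map_pow, hh, map_one]
    have hB1 : B ≠ 1 := by
      rw [← LinearMap.toMatrix_one c]
      exact fun e => h1 ((LinearMap.toMatrix c c).injective e)
    have hTT : T * T' = 1 := by
      rw [← LinearMap.toMatrix_comp]; simp
    have hTT' : T' * T = 1 := by
      rw [← LinearMap.toMatrix_comp]; simp
    have hT : T * (A ⊗ₖ (1 : Matrix _ _ k)) = (A ⊗ₖ B) * T := by
      rw [← LinearMap.toMatrix_one c, ← TensorProduct.toMatrix_map, ← TensorProduct.toMatrix_map,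
        ← LinearMap.toMatrix_comp, ← LinearMap.toMatrix_comp]
      exact congrArg _ hΘ
    have key := Matrix.prime_mul_rank_sum_pow hp (K := K)
      (by rw [← map_natCast φ, Ne, map_eq_zero]; exact hpk) (φ.mapMatrix A) (φ.mapMatrix B)
      (by rw [← map_pow, hA, map_one]) (by rw [← map_pow, hB, map_one])
      (fun e => hB1 (Matrix.map_injective φ.injective (by simpa using e)))
      ⟨φ.mapMatrix T, φ.mapMatrix T', by rw [← map_mul, hTT, map_one],
        by rw [← map_mul, hTT', map_one]⟩
      (by
        have h2 : ∀ (X : Matrix (Fin (Module.finrank k M)) (Fin (Module.finrank k M)) k)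
            (Y : Matrix (Fin (Module.finrank k V)) (Fin (Module.finrank k V)) k),
            (φ.mapMatrix X) ⊗ₖ (φ.mapMatrix Y) = φ.mapMatrix (X ⊗ₖ Y) := by
          intro X Y
          ext
          simp
        have h3 := congrArg φ.mapMatrix hT
        rw [map_mul, map_mul, ← h2, ← h2, map_one] at h3
        exact h3)
    simp_rw [← map_pow] at key
    rw [← map_sum, RingHom.mapMatrix_apply, Matrix.rank_map_algebraMap, Fintype.card_fin] at key
    rw [← key]
    have hsum : ∑ i ∈ Finset.range p, A ^ i = LinearMap.toMatrix b b (cyclicNorm p f) := by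
      show ∑ i ∈ Finset.range p, LinearMap.toMatrixAlgEquiv b f ^ i =
        LinearMap.toMatrixAlgEquiv b (cyclicNorm p f)
      rw [cyclicNorm, map_sum]
      simp_rw [map_pow]
    rw [hsum, Matrix.rank_eq_finrank_range_toLin _ b b, Matrix.toLin_toMatrix]

end Freeness

/-! ### Freeness over the group algebra of a grouplike element -/

section GroupLikeAction

variable {k H : Type*} [Field k] [Ring H] [HopfAlgebra k H]

open Coalgebra TensorProduct

variable (k) in
/-- The map `a ⊗ b ↦ ∑ a₁ ⊗ F(a₂) b`. For `F = id` it is the Galois map of `H`, whose inverse is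
obtained for `F` the antipode. -/
def galoisMap (F : H →ₗ[k] H) : H ⊗[k] H →ₗ[k] H ⊗[k] H :=
  (LinearMap.mul' k H ∘ₗ F.rTensor H).lTensor H ∘ₗ
    (TensorProduct.assoc k H H H).toLinearMap ∘ₗ (comul (R := k) (A := H)).rTensor H

lemma galoisMap_tmul (F : H →ₗ[k] H) (a b : H) :
    galoisMap k F (a ⊗ₜ b) =
      (LinearMap.mulRight k b ∘ₗ F).lTensor H (comul (R := k) a) := by
  simp only [galoisMap, LinearMap.comp_apply, LinearMap.rTensor_tmul, LinearEquiv.coe_coe]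
  induction comul (R := k) a with
  | zero => simp
  | tmul x y => simp
  | add x y hx hy => simp only [add_tmul, map_add, hx, hy]

lemma galoisMap_antipode_comp_galoisMap_id :
    galoisMap k (HopfAlgebra.antipode k (A := H)) ∘ₗ galoisMap k LinearMap.id =
      LinearMap.id := by
  ext a b
  -- `ν (x ⊗ y) = S(x) y b`
  let ν : H ⊗[k] H →ₗ[k] H := LinearMap.mulRight k b ∘ₗ LinearMap.mul' k H ∘ₗ
    (HopfAlgebra.antipode k (A := H)).rTensor H
  have h1 : galoisMap k (HopfAlgebra.antipode k (A := H)) ∘ₗ (LinearMap.mulRight k b).lTensor H =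
      ν.lTensor H ∘ₗ (TensorProduct.assoc k H H H).toLinearMap ∘ₗ
        (comul (R := k) (A := H)).rTensor H := by
    ext x y
    simp only [AlgebraTensorModule.curry_apply, curry_apply, LinearMap.coe_restrictScalars,
      LinearMap.comp_apply, LinearMap.lTensor_tmul, galoisMap_tmul, LinearMap.rTensor_tmul,
      LinearEquiv.coe_coe]
    induction comul (R := k) x with
    | zero => simp
    | tmul x y => simp [ν, mul_assoc]
    | add x y hx hy => simp only [add_tmul, map_add, hx, hy]
  have h2 : ν ∘ₗ comul (R := k) = LinearMap.toSpanSingleton k H b ∘ₗ counit (R := k) := by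
    ext c
    simp only [ν, LinearMap.comp_apply, HopfAlgebra.mul_antipode_rTensor_comul_apply]
    simp [Algebra.algebraMap_eq_smul_one]
  have h3 := LinearMap.congr_fun h1 (comul (R := k) a)
  simp only [LinearMap.comp_apply, LinearEquiv.coe_coe, Coalgebra.coassoc_apply] at h3
  rw [← LinearMap.comp_apply (ν.lTensor H), ← LinearMap.lTensor_comp, h2, LinearMap.lTensor_comp,
    LinearMap.comp_apply, Coalgebra.lTensor_counit_comul] at h3
  simpa [galoisMap_tmul] using h3

/-- An injective endomorphism of a finite-dimensional space that preserves the image of an injection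
restricts to an automorphism of the source of that injection. -/
lemma exists_linearEquiv_of_range_le {W W' : Type*} [AddCommGroup W] [Module k W] [AddCommGroup W']
    [Module k W'] [FiniteDimensional k W] (e : W →ₗ[k] W') (he : Function.Injective e)
    (θ : W' →ₗ[k] W') (hθ : Function.Injective θ) (hle : ∀ w, θ (e w) ∈ LinearMap.range e) :
    ∃ Θ : W ≃ₗ[k] W, ∀ w, e (Θ w) = θ (e w) := by
  let τ : W →ₗ[k] W := (LinearEquiv.ofInjective e he).symm.toLinearMap ∘ₗ
    (θ ∘ₗ e).codRestrict (LinearMap.range e) hle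
  have hτ : ∀ w, e (τ w) = θ (e w) := fun w =>
    congrArg Subtype.val
      ((LinearEquiv.ofInjective e he).apply_symm_apply ⟨θ (e w), hle w⟩)
  have hinj : Function.Injective τ := fun x y hxy => by
    apply he
    apply hθ
    rw [← hτ, ← hτ, hxy]
  exact ⟨LinearEquiv.ofInjectiveEndo τ hinj, hτ⟩

lemma GroupLike.sum_pow_ne_zero {p : ℕ} (hp : p ≠ 0) (g : GroupLike k H) (hg : orderOf g = p) :
    ∑ i ∈ Finset.range p, (g : H) ^ i ≠ 0 := by
  intro h0
  have hinj : Function.Injective fun i : Fin p => g ^ (i : ℕ) := fun i j hij =>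
    Fin.ext (pow_injOn_Iio_orderOf (by simp [hg]) (by simp [hg]) hij)
  have hli := (linearIndep_groupLikeVal (R := k) (A := H)).comp _ hinj
  have h1 := Fintype.linearIndependent_iff.1 hli (fun _ => 1)
    (by simpa [Fin.sum_univ_eq_sum_range (fun i => (g : H) ^ i)] using h0)
  exact one_ne_zero (h1 ⟨0, Nat.pos_of_ne_zero hp⟩)

variable [FiniteDimensional k H]

/-- A relative Hopf module inside `H` is free over the group algebra of a grouplike element of
prime order: if `M ⊆ H` is a right coideal stable under left multiplication by `g`, the norm element
of `g` has rank `dim M / p` on `M`. The inclusion of `M` is the map `e`. -/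
theorem GroupLike.prime_mul_finrank_range_cyclicNorm {p : ℕ} (hp : p.Prime) (g : GroupLike k H)
    (hg : orderOf g = p) {M : Type*} [AddCommGroup M] [Module k M] (e : M →ₗ[k] H)
    (he : Function.Injective e) (f : Module.End k M) (hf : ∀ m, e (f m) = g * e m)
    (hΔ : ∀ m, comul (R := k) (e m) ∈ LinearMap.range (e.rTensor H)) :
    p * Module.finrank k (LinearMap.range (cyclicNorm p f)) = Module.finrank k M := by
  have : FiniteDimensional k M := FiniteDimensional.of_injective e he
  have hgp : (g : H) ^ p = 1 := by
    rw [← GroupLike.val_pow, ← hg, pow_orderOf_eq_one, GroupLike.val_one]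
  have hg1 : (g : H) ≠ 1 := fun h => hp.one_lt.ne' <| by
    rw [← hg, orderOf_eq_one_iff]
    exact GroupLike.val_injective h
  have hfn : ∀ (n : ℕ) m, e ((f ^ n) m) = (g : H) ^ n * e m := by
    intro n
    induction n with
    | zero => simp
    | succ n ih => intro m; rw [pow_succ, Module.End.mul_apply, ih, hf, pow_succ, mul_assoc]
  have hcomm : ∀ (b : H), (LinearMap.mulRight k b).lTensor H ∘ₗ e.rTensor H =
      e.rTensor H ∘ₗ (LinearMap.mulRight k b).lTensor M := by
    intro b; ext; simp
  have heinj : Function.Injective (e.rTensor H) :=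
    Module.Flat.rTensor_preserves_injective_linearMap _ he
  obtain ⟨Θ, hΘ⟩ := exists_linearEquiv_of_range_le (e.rTensor H) heinj
    (galoisMap k LinearMap.id)
    (Function.LeftInverse.injective
      (g := galoisMap k (HopfAlgebra.antipode k (A := H))) fun x =>
      LinearMap.congr_fun (galoisMap_antipode_comp_galoisMap_id (k := k) (H := H)) x) (by
      intro w
      induction w with
      | zero => simp
      | add x y hx hy => rw [map_add, map_add]; exact Submodule.add_mem _ hx hy
      | tmul m b =>
        obtain ⟨t, ht⟩ := hΔ m
        rw [LinearMap.rTensor_tmul, galoisMap_tmul, ← ht, LinearMap.comp_id]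
        exact ⟨_, (LinearMap.congr_fun (hcomm b) t).symm⟩)
  refine _root_.prime_mul_finrank_range_cyclicNorm hp (h := LinearMap.mulLeft k (g : H)) ?_ ?_ ?_ ?_
    Θ ?_
  · ext m
    apply he
    rw [hfn, hgp, one_mul, Module.End.one_apply]
  · rw [LinearMap.pow_mulLeft, hgp, LinearMap.mulLeft_one]; rfl
  · intro h
    have := LinearMap.congr_fun h 1
    exact hg1 (by simpa using this)
  · intro h
    have := LinearMap.congr_fun h 1
    exact g.sum_pow_ne_zero hp.ne_zero hg (by
      simpa [cyclicNorm, LinearMap.pow_mulLeft, LinearMap.sum_apply] using this)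
  · have h1 : e.rTensor H ∘ₗ TensorProduct.map f (LinearMap.mulLeft k (g : H)) =
        LinearMap.mulLeft k ((g : H) ⊗ₜ[k] (g : H)) ∘ₗ e.rTensor H := by
      ext; simp [hf]
    ext m b
    apply heinj
    show e.rTensor H (Θ (f m ⊗ₜ b)) = (e.rTensor H ∘ₗ TensorProduct.map f _) (Θ (m ⊗ₜ b))
    rw [h1, LinearMap.comp_apply, hΘ, hΘ]
    simp only [LinearMap.rTensor_tmul, galoisMap_tmul, LinearMap.comp_id, hf,
      Bialgebra.comul_mul, g.isGroupLikeElem_val.comul_eq_tmul_self, LinearMap.mulLeft_apply]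
    induction comul (R := k) (e m) with
    | zero => simp
    | tmul x y => simp [mul_assoc]
    | add x y hx hy => simp only [mul_add, map_add, hx, hy]

end GroupLikeAction

/-! ### Characters and the divisibility of the dimension -/

section Slices

variable {k A B : Type*} [Field k] [Ring A] [Algebra k A] [Ring B] [Algebra k B]

/-- Evaluation `χ ⊗ id` of the left tensor factor at a character `χ`. -/
def evalLeft (B : Type*) [Ring B] [Algebra k B] (χ : A →ₐ[k] k) : A ⊗[k] B →ₐ[k] B :=
  (Algebra.TensorProduct.lid k B).toAlgHom.comp (Algebra.TensorProduct.map χ (AlgHom.id k B))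

/-- Evaluation `id ⊗ χ` of the right tensor factor at a character `χ`. -/
def evalRight (A : Type*) [Ring A] [Algebra k A] (χ : B →ₐ[k] k) : A ⊗[k] B →ₐ[k] A :=
  (Algebra.TensorProduct.rid k k A).toAlgHom.comp (Algebra.TensorProduct.map (AlgHom.id k A) χ)

@[simp] lemma evalLeft_tmul (χ : A →ₐ[k] k) (a : A) (b : B) :
    evalLeft B χ (a ⊗ₜ b) = χ a • b := by
  simp [evalLeft]

@[simp] lemma evalRight_tmul (χ : B →ₐ[k] k) (a : A) (b : B) :
    evalRight A χ (a ⊗ₜ b) = χ b • a := by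
  simp [evalRight]

lemma evalRight_comm (χ : A →ₐ[k] k) (t : A ⊗[k] B) :
    evalRight B χ (TensorProduct.comm k A B t) = evalLeft B χ t := by
  induction t with
  | zero => simp
  | tmul x y => simp
  | add x y hx hy => simp only [map_add, hx, hy]

lemma evalLeft_comm (χ : B →ₐ[k] k) (t : A ⊗[k] B) :
    evalLeft A χ (TensorProduct.comm k A B t) = evalRight A χ t := by
  induction t with
  | zero => simp
  | tmul x y => simp
  | add x y hx hy => simp only [map_add, hx, hy]

lemma apply_evalLeft_eq_apply_evalRight (χ : A →ₐ[k] k) (t : A ⊗[k] A) :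
    χ (evalLeft A χ t) = χ (evalRight A χ t) := by
  induction t with
  | zero => simp
  | tmul x y => simp [mul_comm]
  | add x y hx hy => simp only [map_add, hx, hy]

end Slices

open Coalgebra TensorProduct

namespace GroupLike

variable {k H : Type*} [Field k] [Ring H] [HopfAlgebra k H] [FiniteDimensional k H]

/-- A grouplike element of `H^*` is a character of the algebra `H`. -/
def character (α : GroupLike k (HopfDual k H)) : H →ₐ[k] k :=
  AlgHom.ofLinearMap (HopfDual.toDual k H α.val)
    (by
      have := α.isGroupLikeElem_val.counit_eq_one
      rwa [HopfDual.counit_def] at this)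
    (fun a b => by
      have := congrArg (fun t => HopfDual.pairEquiv k H t (a ⊗ₜ b))
        α.isGroupLikeElem_val.comul_eq_tmul_self
      simpa only [HopfDual.comul_def, HopfDual.pair_comulMap, HopfDual.pairEquiv_tmul,
        HopfDual.toDual_apply] using this)

lemma character_apply (α : GroupLike k (HopfDual k H)) (a : H) : α.character a = α.val a := rfl

/-- The algebra endomorphism `h ↦ ∑ α(h₁) h₂` of `H`; its transpose is left multiplication by `α`. -/
def leftShift (α : GroupLike k (HopfDual k H)) : H →ₐ[k] H :=
  (evalLeft H α.character).comp (Bialgebra.comulAlgHom k H)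

/-- The algebra endomorphism `h ↦ ∑ h₁ α(h₂)` of `H`; its transpose is right multiplication by
`α`. -/
def rightShift (α : GroupLike k (HopfDual k H)) : H →ₐ[k] H :=
  (evalRight H α.character).comp (Bialgebra.comulAlgHom k H)

lemma leftShift_apply (α : GroupLike k (HopfDual k H)) (h : H) :
    α.leftShift h = evalLeft H α.character (comul (R := k) h) := rfl

lemma rightShift_apply (α : GroupLike k (HopfDual k H)) (h : H) :
    α.rightShift h = evalRight H α.character (comul (R := k) h) := rfl

lemma mul_apply_eq_leftShift (α : GroupLike k (HopfDual k H)) (f : HopfDual k H) (h : H) :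
    (α.val * f) h = f (α.leftShift h) := by
  rw [HopfDual.mul_def, leftShift_apply]
  induction comul (R := k) h with
  | zero => simp
  | tmul x y => simp [character_apply]
  | add x y hx hy => simp only [map_add, hx, hy]

lemma mul_apply_eq_rightShift (α : GroupLike k (HopfDual k H)) (f : HopfDual k H) (h : H) :
    (f * α.val) h = f (α.rightShift h) := by
  rw [HopfDual.mul_def, rightShift_apply]
  induction comul (R := k) h with
  | zero => simp
  | tmul x y => simp [character_apply, mul_comm]
  | add x y hx hy => simp only [map_add, hx, hy]

lemma rightShift_surjective (α : GroupLike k (HopfDual k H)) :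
    Function.Surjective α.rightShift := by
  have h : Function.Injective α.rightShift.toLinearMap.dualMap := by
    intro f f' hff
    have h1 : (HopfDual.toDual k H).symm f * α.val = (HopfDual.toDual k H).symm f' * α.val := by
      ext a
      rw [α.mul_apply_eq_rightShift, α.mul_apply_eq_rightShift]
      exact LinearMap.congr_fun hff a
    exact (HopfDual.toDual k H).symm.injective (α.isGroupLikeElem_val.isUnit.mul_left_injective h1)
  exact LinearMap.dualMap_injective_iff.1 h

lemma comul_leftShift (α : GroupLike k (HopfDual k H)) (h : H) :
    comul (R := k) (α.leftShift h) =
      α.leftShift.toLinearMap.rTensor H (comul (R := k) h) := by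
  have h1 : ∀ t : H ⊗[k] H, comul (R := k) (evalLeft H α.character t) =
      evalLeft (H ⊗[k] H) α.character ((comul (R := k)).lTensor H t) := by
    intro t
    induction t with
    | zero => simp
    | tmul x y => simp
    | add x y hx hy => simp only [map_add, hx, hy]
  have h2 : ∀ t : H ⊗[k] H, evalLeft (H ⊗[k] H) α.character
      (TensorProduct.assoc k H H H ((comul (R := k)).rTensor H t)) =
        α.leftShift.toLinearMap.rTensor H t := by
    intro t
    induction t with
    | zero => simp
    | add x y hx hy => simp only [map_add, hx, hy]
    | tmul x y =>
      simp only [LinearMap.rTensor_tmul, AlgHom.toLinearMap_apply, leftShift_apply]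
      induction comul (R := k) x with
      | zero => simp
      | tmul x z => simp [smul_tmul']
      | add x z hx hz => simp only [map_add, add_tmul, hx, hz]
  rw [leftShift_apply, h1, ← Coalgebra.coassoc_apply, h2]

lemma leftShift_mul_of_apply_eq_one {α : GroupLike k (HopfDual k H)} {g : GroupLike k H}
    (h : α.val g.val = 1) (a : H) : α.leftShift (g * a) = g * α.leftShift a := by
  rw [map_mul, leftShift_apply α g.val, g.isGroupLikeElem_val.comul_eq_tmul_self, evalLeft_tmul,
    character_apply, h, one_smul]

/-- A grouplike `g` of prime order `p` and a character `α` of order `p` with `α(g) = 1` force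
`p² ∣ dim H`: the image of the norm element of `α` on `H` has dimension `dim H / p`, and it is again
free over the group algebra of `g`. -/
theorem sq_dvd_finrank {p : ℕ} (hp : p.Prime) {g : GroupLike k H}
    {α : GroupLike k (HopfDual k H)} (hg : orderOf g = p) (hα : orderOf α = p)
    (h : α.val g.val = 1) : p ^ 2 ∣ Module.finrank k H := by
  let l : Module.End k H := α.leftShift.toLinearMap
  have hln : ∀ (n : ℕ) (f : HopfDual k H) (a : H), (α.val ^ n * f) a = f ((l ^ n) a) := by
    intro n
    induction n with
    | zero => simp
    | succ n ih =>
      intro f a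
      rw [pow_succ', mul_assoc, mul_apply_eq_leftShift, ih, pow_succ]
      rfl
  set N := cyclicNorm p l with hN
  have h1 : p * Module.finrank k (LinearMap.range N) = Module.finrank k H := by
    have h0 := α.prime_mul_finrank_range_cyclicNorm hp hα (LinearMap.id (R := k))
      Function.injective_id (LinearMap.mulLeft k α.val) (fun _ => rfl)
      (fun m => by rw [LinearMap.rTensor_id]; exact ⟨_, rfl⟩)
    -- `N` is the transpose of the norm element of `α` acting on `H^*` by left multiplication.
    have h2 : (HopfDual.toDual k H).toLinearMap ∘ₗ cyclicNorm p (LinearMap.mulLeft k α.val) =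
        N.dualMap ∘ₗ (HopfDual.toDual k H).toLinearMap := by
      ext f a
      have : ∀ (s : Finset ℕ), ((∑ i ∈ s, LinearMap.mulLeft k α.val ^ i) f) a =
          f ((∑ i ∈ s, l ^ i) a) := by
        intro s
        induction s using Finset.induction_on with
        | empty => simp
        | insert i s hi ih =>
          rw [Finset.sum_insert hi, Finset.sum_insert hi, LinearMap.add_apply,
            HopfDual.add_apply, ih, LinearMap.add_apply, map_add, LinearMap.pow_mulLeft,
            LinearMap.mulLeft_apply, hln]
      exact this _
    have h3 := LinearMap.finrank_range_dualMap_eq_finrank_range N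
    rw [← LinearMap.range_comp_of_range_eq_top N.dualMap (HopfDual.toDual k H).range, ← h2,
      LinearMap.range_comp, LinearEquiv.finrank_map_eq] at h3
    rw [← h3, h0]
    exact (HopfDual.toDual k H).finrank_eq.trans Subspace.dual_finrank_eq
  have hlg : ∀ (n : ℕ) a, (l ^ n) (g * a) = g * (l ^ n) a := by
    intro n
    induction n with
    | zero => simp
    | succ n ih =>
      intro a
      rw [pow_succ', Module.End.mul_apply, ih, Module.End.mul_apply]
      exact leftShift_mul_of_apply_eq_one h _
  -- The image of `N` is stable under `g` and is a right coideal.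
  have hNg : ∀ a, N (g * a) = g * N a := by
    intro a
    simp [hN, cyclicNorm, LinearMap.sum_apply, hlg, Finset.mul_sum]
  have hlΔ : ∀ (n : ℕ) a, comul (R := k) ((l ^ n) a) = (l ^ n).rTensor H (comul (R := k) a) := by
    intro n
    induction n with
    | zero => simp [Module.End.one_eq_id]
    | succ n ih =>
      intro a
      rw [pow_succ', Module.End.mul_apply, Module.End.mul_eq_comp, LinearMap.rTensor_comp,
        LinearMap.comp_apply, ← ih]
      exact comul_leftShift α _
  have hNΔ : ∀ a, comul (R := k) (N a) = N.rTensor H (comul (R := k) a) := by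
    intro a
    have : ∀ s : Finset ℕ, comul (R := k) ((∑ i ∈ s, l ^ i) a) =
        (∑ i ∈ s, l ^ i).rTensor H (comul (R := k) a) := by
      intro s
      induction s using Finset.induction_on with
      | empty => simp
      | insert i s hi ih =>
        rw [Finset.sum_insert hi, LinearMap.add_apply, map_add, ih, hlΔ, LinearMap.rTensor_add,
          LinearMap.add_apply]
    exact this _
  have h2 := g.prime_mul_finrank_range_cyclicNorm hp hg (LinearMap.range N).subtype
    (Submodule.subtype_injective _)
    ((LinearMap.mulLeft k g.val).restrict (p := LinearMap.range N) (q := LinearMap.range N) (by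
      rintro _ ⟨a, rfl⟩
      exact ⟨g * a, hNg a⟩)) (fun _ => rfl) (by
      rintro ⟨_, a, rfl⟩
      refine ⟨N.rangeRestrict.rTensor H (comul (R := k) a), ?_⟩
      rw [← LinearMap.comp_apply, ← LinearMap.rTensor_comp]
      exact (hNΔ a).symm)
  rw [← h1, ← h2, ← mul_assoc, sq]
  exact dvd_mul_right _ _

end GroupLike

/-! ### Grouplike elements from a universal `R`-matrix -/

/-- An invertible `g` with `Δ(g) = g ⊗ g` is grouplike: the counit condition is automatic. -/
lemma IsGroupLikeElem.of_isUnit {k H : Type*} [Field k] [Ring H] [HopfAlgebra k H] {g : H}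
    (hu : IsUnit g) (hg : comul (R := k) g = g ⊗ₜ g) : IsGroupLikeElem k g := by
  refine ⟨?_, hg⟩
  have h1 := Coalgebra.rTensor_counit_comul (R := k) g
  rw [hg, LinearMap.rTensor_tmul] at h1
  have h2 : counit (R := k) g • g = g := by simpa using congrArg (TensorProduct.lid k H) h1
  have : Nontrivial H := Bialgebra.nontrivial (R := k)
  have h3 : (counit (R := k) g - 1) • g = 0 := by rw [sub_smul, h2, one_smul, sub_self]
  exact sub_eq_zero.1 ((smul_eq_zero.1 h3).resolve_right hu.ne_zero)


namespace IsUniversalRMatrix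

variable {k H : Type*} [Field k] [Ring H] [HopfAlgebra k H] {R : (H ⊗[k] H)ˣ}

lemma comul_evalLeft (hR : IsUniversalRMatrix k R) (χ : H →ₐ[k] k) :
    comul (R := k) (evalLeft H χ (R : H ⊗[k] H)) =
      evalLeft H χ (R : H ⊗[k] H) ⊗ₜ evalLeft H χ (R : H ⊗[k] H) := by
  have h := congrArg (evalLeft (H ⊗[k] H) χ) hR.comul_right
  have h1 : ∀ t : H ⊗[k] H, evalLeft (H ⊗[k] H) χ ((comul (R := k)).lTensor H t) =
      comul (R := k) (evalLeft H χ t) := by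
    intro t
    induction t with
    | zero => simp
    | tmul x y => simp
    | add x y hx hy => simp only [map_add, hx, hy]
  have h2 : (evalLeft (H ⊗[k] H) χ).comp (leg13 k) =
      Algebra.TensorProduct.includeRight.comp (evalLeft H χ) := by
    ext <;> simp [leg13]
  have h3 : (evalLeft (H ⊗[k] H) χ).comp (leg12 k) =
      Algebra.TensorProduct.includeLeft.comp (evalLeft H χ) := by
    ext <;> simp [leg12]
  rw [h1, map_mul, ← AlgHom.comp_apply, ← AlgHom.comp_apply, h2, h3] at h
  simpa using h

lemma comul_evalRight (hR : IsUniversalRMatrix k R) (χ : H →ₐ[k] k) :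
    comul (R := k) (evalRight H χ (R : H ⊗[k] H)) =
      evalRight H χ (R : H ⊗[k] H) ⊗ₜ evalRight H χ (R : H ⊗[k] H) := by
  let E : H ⊗[k] (H ⊗[k] H) →ₐ[k] H ⊗[k] H :=
    Algebra.TensorProduct.map (AlgHom.id k H) (evalRight H χ)
  have h := congrArg E hR.comul_left
  have h1 : ∀ t : H ⊗[k] H, E (TensorProduct.assoc k H H H ((comul (R := k)).rTensor H t)) =
      comul (R := k) (evalRight H χ t) := by
    intro t
    induction t with
    | zero => simp
    | add x y hx hy => simp only [map_add, hx, hy]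
    | tmul x y =>
      rw [LinearMap.rTensor_tmul, evalRight_tmul, map_smul]
      induction comul (R := k) x with
      | zero => simp
      | tmul x z => simp [E]
      | add x z hx hz => simp only [map_add, add_tmul, smul_add, hx, hz]
  have h2 : E.comp (leg13 k) = Algebra.TensorProduct.includeLeft.comp (evalRight H χ) := by
    ext <;> simp [leg13, E, smul_tmul']
  have h3 : E.comp (leg23 k) = Algebra.TensorProduct.includeRight.comp (evalRight H χ) := by
    ext <;> simp [leg23, E]
  rw [h1, map_mul, ← AlgHom.comp_apply, ← AlgHom.comp_apply, h2, h3] at h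
  simpa using h

lemma comul_op_mul (hR : IsUniversalRMatrix k R) (h : H) :
    TensorProduct.comm k H H (comul (R := k) h) * (R : H ⊗[k] H) =
      (R : H ⊗[k] H) * comul (R := k) h := by
  rw [hR.comul_op, Units.inv_mul_cancel_right]

variable [FiniteDimensional k H]

lemma evalLeft_character_mul (hR : IsUniversalRMatrix k R) (α β : GroupLike k (HopfDual k H)) :
    evalLeft H (α * β).character (R : H ⊗[k] H) =
      evalLeft H α.character (R : H ⊗[k] H) * evalLeft H β.character (R : H ⊗[k] H) := by
  let E : H ⊗[k] (H ⊗[k] H) →ₐ[k] H := (evalLeft H β.character).comp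
    (evalLeft (H ⊗[k] H) α.character)
  have h := congrArg E hR.comul_left
  have h1 : ∀ t : H ⊗[k] H, E (TensorProduct.assoc k H H H ((comul (R := k)).rTensor H t)) =
      evalLeft H (α * β).character t := by
    intro t
    induction t with
    | zero => simp
    | add x y hx hy => simp only [map_add, hx, hy]
    | tmul x y =>
      rw [LinearMap.rTensor_tmul, evalLeft_tmul, GroupLike.character_apply, GroupLike.val_mul,
        HopfDual.mul_def]
      induction comul (R := k) x with
      | zero => simp
      | tmul x z => simp [E, GroupLike.character_apply, mul_smul]
      | add x z hx hz => simp only [map_add, add_tmul, add_smul, hx, hz]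
  have h2 : E.comp (leg13 k) = evalLeft H α.character := by
    ext <;> simp [leg13, E]
  have h3 : E.comp (leg23 k) = evalLeft H β.character := by
    ext <;> simp [leg23, E]
  rw [h1, map_mul, ← AlgHom.comp_apply, ← AlgHom.comp_apply, h2, h3] at h
  exact h

/-- The group homomorphism `G(H^*) → G(H)`, `α ↦ (α ⊗ id)(R)`. -/
def groupLikeHom (hR : IsUniversalRMatrix k R) :
    GroupLike k (HopfDual k H) →* GroupLike k H :=
  MonoidHom.mk' (fun α => ⟨evalLeft H α.character (R : H ⊗[k] H),
    .of_isUnit (R.isUnit.map (evalLeft H α.character)) (hR.comul_evalLeft _)⟩)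
    (fun α β => GroupLike.val_injective (hR.evalLeft_character_mul α β))

/-- The grouplike element `(id ⊗ α)(R)`. -/
def rightGroupLike (hR : IsUniversalRMatrix k R) (α : GroupLike k (HopfDual k H)) :
    GroupLike k H :=
  ⟨evalRight H α.character (R : H ⊗[k] H),
    .of_isUnit (R.isUnit.map (evalRight H α.character)) (hR.comul_evalRight _)⟩

lemma rightShift_mul_groupLikeHom (hR : IsUniversalRMatrix k R) (α : GroupLike k (HopfDual k H))
    (h : H) : α.rightShift h * (hR.groupLikeHom α).val =
      (hR.groupLikeHom α).val * α.leftShift h := by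
  have := congrArg (evalLeft H α.character) (hR.comul_op_mul h)
  rwa [map_mul, map_mul, evalLeft_comm] at this

lemma leftShift_mul_rightGroupLike (hR : IsUniversalRMatrix k R) (α : GroupLike k (HopfDual k H))
    (h : H) : α.leftShift h * (hR.rightGroupLike α).val =
      (hR.rightGroupLike α).val * α.rightShift h := by
  have := congrArg (evalRight H α.character) (hR.comul_op_mul h)
  rwa [map_mul, map_mul, evalRight_comm] at this

/-- If `H` has no nontrivial central grouplike element, `(α ⊗ id)(R)` and `(id ⊗ α)(R)` are inverse
to each other: their product commutes with every `∑ h₁ α(h₂)`, so it is central. -/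
lemma groupLikeHom_mul_rightGroupLike (hR : IsUniversalRMatrix k R)
    (hZ : {g : H | IsGroupLikeElem k g} ∩ Set.center H = {1})
    (α : GroupLike k (HopfDual k H)) : hR.groupLikeHom α * hR.rightGroupLike α = 1 := by
  apply GroupLike.val_injective
  rw [GroupLike.val_one, ← Set.mem_singleton_iff, ← hZ]
  refine ⟨(hR.groupLikeHom α * hR.rightGroupLike α).isGroupLikeElem_val, ?_⟩
  rw [Semigroup.mem_center_iff]
  intro h
  obtain ⟨h, rfl⟩ := α.rightShift_surjective h
  rw [GroupLike.val_mul, ← mul_assoc, hR.rightShift_mul_groupLikeHom, mul_assoc,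
    hR.leftShift_mul_rightGroupLike, mul_assoc]

/-- If `H^*` has no nontrivial central grouplike element, `G(H^*)` embeds into `G(H)`. -/
lemma groupLikeHom_injective (hR : IsUniversalRMatrix k R)
    (hZ : {α : HopfDual k H | IsGroupLikeElem k α} ∩ Set.center (HopfDual k H) = {1}) :
    Function.Injective hR.groupLikeHom := by
  rw [injective_iff_map_eq_one]
  intro α hα
  apply GroupLike.val_injective
  rw [GroupLike.val_one, ← Set.mem_singleton_iff, ← hZ]
  refine ⟨α.isGroupLikeElem_val, ?_⟩
  rw [Semigroup.mem_center_iff]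
  intro f
  ext h
  have h1 := hR.rightShift_mul_groupLikeHom α h
  rw [hα, GroupLike.val_one, mul_one, one_mul] at h1
  rw [α.mul_apply_eq_rightShift, α.mul_apply_eq_leftShift, h1]

/-- The heart of the obstruction: every odd prime dividing `|G(H^*)|` is the order of a grouplike
`g` and of a character `α` with `α(g) = 1`. Here `g = (α ⊗ id)(R)`, so that
`α(g) = (α ⊗ α)(R) = α(g⁻¹)`. -/
theorem exists_apply_eq_one (hR : IsUniversalRMatrix k R)
    (hZd : {α : HopfDual k H | IsGroupLikeElem k α} ∩ Set.center (HopfDual k H) = {1})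
    (hZ : {g : H | IsGroupLikeElem k g} ∩ Set.center H = {1}) {p : ℕ} (hp : p.Prime)
    (hodd : Odd p) (hdvd : p ∣ Nat.card (GroupLike k (HopfDual k H))) :
    ∃ (g : GroupLike k H) (α : GroupLike k (HopfDual k H)),
      orderOf g = p ∧ orderOf α = p ∧ α.val g.val = 1 := by
  have : Fact p.Prime := ⟨hp⟩
  have : Finite (GroupLike k (HopfDual k H)) :=
    (linearIndep_groupLikeVal (R := k) (A := HopfDual k H)).finite
  obtain ⟨α, hα⟩ := exists_prime_orderOf_dvd_card' p hdvd
  have hg : orderOf (hR.groupLikeHom α) = p := by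
    rw [orderOf_injective _ (hR.groupLikeHom_injective hZd), hα]
  refine ⟨hR.groupLikeHom α, α, hg, hα, ?_⟩
  set g := hR.groupLikeHom α with hgdef
  have hsq : α.character g.val ^ 2 = 1 := by
    have h1 := congrArg (fun x : GroupLike k H => α.character x.val)
      (hR.groupLikeHom_mul_rightGroupLike hZ α)
    have h2 : α.character (hR.rightGroupLike α).val = α.character g.val :=
      (apply_evalLeft_eq_apply_evalRight _ _).symm
    rw [sq]
    nth_rw 2 [← h2]
    simpa using h1
  have hpow : α.character g.val ^ p = 1 := by
    rw [← map_pow, ← GroupLike.val_pow, ← hg, pow_orderOf_eq_one, GroupLike.val_one, map_one]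
  have hcop : Nat.Coprime 2 p := hodd.coprime_two_left
  have : α.character g.val = 1 := by
    have h3 := orderOf_dvd_of_pow_eq_one hsq
    have h4 := orderOf_dvd_of_pow_eq_one hpow
    exact orderOf_eq_one_iff.1 (Nat.eq_one_of_dvd_coprimes hcop h3 h4)
  exact this

end IsUniversalRMatrix

end

theorem mainTheorem4 {k H : Type*} [Field k] [Ring H] [HopfAlgebra k H]
    [FiniteDimensional k H] :
    -- the obstruction
    (Nat.card (GroupLike k (HopfDual k H)) ≠ 1 →
      {α : HopfDual k H | IsGroupLikeElem k α} ∩ Set.center (HopfDual k H) = {1} →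
      {g : H | IsGroupLikeElem k g} ∩ Set.center H = {1} →
      (∃ p : ℕ, p.Prime ∧ Odd p ∧ p ∣ Nat.card (GroupLike k (HopfDual k H)) ∧
        ∀ (g : GroupLike k H) (α : GroupLike k (HopfDual k H)),
          orderOf g = p → orderOf α = p → α.val g.val ≠ 1) →
      ¬ ∃ R : (H ⊗[k] H)ˣ, IsUniversalRMatrix k R) ∧
    -- the four cases for a quasitriangular Hopf algebra
    ((∃ R : (H ⊗[k] H)ˣ, IsUniversalRMatrix k R) →
      Nat.card (GroupLike k (HopfDual k H)) = 1 ∨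
      (Nat.card (GroupLike k (HopfDual k H)) ≠ 1 ∧
        {α : HopfDual k H | IsGroupLikeElem k α} ∩ Set.center (HopfDual k H) ≠ {1}) ∨
      (Nat.card (GroupLike k (HopfDual k H)) ≠ 1 ∧
        {α : HopfDual k H | IsGroupLikeElem k α} ∩ Set.center (HopfDual k H) = {1} ∧
        {g : H | IsGroupLikeElem k g} ∩ Set.center H ≠ {1}) ∨
      (Nat.card (GroupLike k (HopfDual k H)) ≠ 1 ∧
        {α : HopfDual k H | IsGroupLikeElem k α} ∩ Set.center (HopfDual k H) = {1} ∧
        {g : H | IsGroupLikeElem k g} ∩ Set.center H = {1} ∧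
        ∀ p : ℕ, p.Prime → Odd p → p ∣ Nat.card (GroupLike k (HopfDual k H)) →
          (∃ (g : GroupLike k H) (α : GroupLike k (HopfDual k H)),
            orderOf g = p ∧ orderOf α = p ∧ α.val g.val = 1) ∧
          p ^ 2 ∣ Module.finrank k H)) := by
  constructor
  · rintro - hZd hZ ⟨p, hp, hodd, hdvd, hne⟩ ⟨R, hR⟩
    obtain ⟨g, α, hg, hα, h⟩ := hR.exists_apply_eq_one hZd hZ hp hodd hdvd
    exact hne g α hg hα h
  · rintro ⟨R, hR⟩
    by_cases h1 : Nat.card (GroupLike k (HopfDual k H)) = 1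
    · exact Or.inl h1
    by_cases hZd : {α : HopfDual k H | IsGroupLikeElem k α} ∩ Set.center (HopfDual k H) = {1}
    swap
    · exact Or.inr (Or.inl ⟨h1, hZd⟩)
    by_cases hZ : {g : H | IsGroupLikeElem k g} ∩ Set.center H = {1}
    swap
    · exact Or.inr (Or.inr (Or.inl ⟨h1, hZd, hZ⟩))
    refine Or.inr (Or.inr (Or.inr ⟨h1, hZd, hZ, fun p hp hodd hdvd => ?_⟩))
    obtain ⟨g, α, hg, hα, h⟩ := hR.exists_apply_eq_one hZd hZ hp hodd hdvd
    exact ⟨⟨g, α, hg, hα, h⟩, GroupLike.sq_dvd_finrank hp hg hα h⟩
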